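/- Notation. For $f:\mathbb F_2^n\to\{-1,1\}$ let $\widehat f(\alpha)=2^{-n}\sum_x f(x)(-1)^{\alpha\cdot x}$, let $\mathcal S=\{\alpha:\widehat f(\alpha)\ne 0\}$ be its Fourier support and $k=k(f)=|\mathcal S|$ its Fourier sparsity. For $\gamma\in\mathbb F_2^n$ let $O_\gamma$ be the set of two-element subsets $\{\alpha,\beta\}\subseteq\mathcal S$ with $\alpha+\beta=\gamma$. For real $\delta,\ell$, the function $f$ is $(\delta,\ell)$-folding if at least $\delta\binom k2$ of the two-element subsets $\{\alpha,\beta\}$ of $\mathcal S$ satisfy $|O_{\alpha+\beta}|\ge k^{\ell}+1$. A parity decision tree is a binary tree whose internal nodes query parities $\chi_\alpha(x)=(-1)^{\alpha\cdot x}$ and branch on the answer in $\{-1,1\}$, and whose leaves are labelled by outputs in $\{-1,1\}$; $\mathrm{PDT}(f)$ is the minimum depth of a parity decision tree that outputs $f(x)$ on every input $x$. Corollary 3. Let $\varepsilon,\delta_0>0$ and $K_0\in\mathbb N$. There are constants $C\in\mathbb{R}$ and $c\in\mathbb N$, depending only on $\varepsilon,\delta_0,K_0$, with the following property. Let the parameters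 $\delta=\delta(k)$ and $\ell=\ell(k)$ be constants or, more generally, functions of $k$, with $\delta(k)\ge\delta_0$ and $0\le\ell(k)\le1-\varepsilon$ for all $k$, and such that $k^{1-\ell(k)}$ is non-decreasing for $k\ge K_0$ (automatic when $\ell$ is constant). Suppose that, for every $m$, every Boolean function $g:\mathbb F_2^m\to\{-1,1\}$ with sparsity $k\ge K_0$ is $(\delta(k),\ell(k))$-folding. Then for every $n$ and every Boolean function $f:\mathbb F_2^n\to\{-1,1\}$ with sparsity $k\ge2$, $$\mathrm{PDT}(f)\le C\,h\,(\log_2 h)^{c},\qquad h=k^{(1-\ell(k))/2},$$ that is, $\mathrm{PDT}(f)=\widetilde O\big(k^{(1-\ell)/2}\big)$. -/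

import Mathlib

namespace PDTree

/-- The vector space of `n`-bit strings over the field with two elements. -/
abbrev Cube (n : ℕ) : Type := Fin n → ZMod 2

/-- Boolean functions with values in `{-1, 1}` (the units of `ℤ`). -/
abbrev BoolFun (n : ℕ) : Type := Cube n → ℤˣ

/-- The character (parity) `χ_α(x) = (-1)^(α₁x₁ + ⋯ + αₙxₙ)`. -/
def chi {n : ℕ} (α x : Cube n) : ℤˣ := (-1 : ℤˣ) ^ (∑ i, α i * x i : ZMod 2)

/-- The Fourier coefficient `E_x [f(x) χ_α(x)]`, `x` uniform. -/
noncomputable def fourierCoeff {n : ℕ} (f : BoolFun n) (α : Cube n) : ℝ :=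
  (1 / 2 ^ n : ℝ) * ∑ x : Cube n, ((f x : ℤ) : ℝ) * ((chi α x : ℤ) : ℝ)

open Classical in
/-- The Fourier support. -/
noncomputable def fourierSupport {n : ℕ} (f : BoolFun n) : Finset (Cube n) :=
  Finset.univ.filter (fun α => fourierCoeff f α ≠ 0)

/-- The Fourier sparsity `k`. -/
noncomputable def sparsity {n : ℕ} (f : BoolFun n) : ℕ := (fourierSupport f).card

/-- The class `O_γ` of the two-element subsets `{α, β}` of the Fourier support with `α + β = γ`. -/
noncomputable def foldClass {n : ℕ} (f : BoolFun n) (γ : Cube n) : Finset (Finset (Cube n)) :=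
  ((fourierSupport f).powersetCard 2).filter (fun P => ∑ α ∈ P, α = γ)

open Classical in
/-- `f` is `(δ, ℓ)`-folding: at least `δ * (k choose 2)` of the two-element subsets `{α, β}` of the
Fourier support satisfy `|O_{α+β}| ≥ k ^ ℓ + 1`. -/
def IsFolding {n : ℕ} (δ ℓ : ℝ) (f : BoolFun n) : Prop :=
  δ * ((sparsity f).choose 2 : ℝ) ≤
    ((((fourierSupport f).powersetCard 2).filter (fun P =>
      (sparsity f : ℝ) ^ ℓ + 1 ≤ ((foldClass f (∑ α ∈ P, α)).card : ℝ))).card : ℝ)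

/-- Parity decision trees on `n` bits: leaves carry a value in `{-1, 1}`, an internal node carries
the queried parity and its two subtrees, for the answers `-1` and `1` in this order. -/
inductive Tree (n : ℕ) : Type
  | leaf (b : ℤˣ) : Tree n
  | node (α : Cube n) (neg pos : Tree n) : Tree n

/-- The output of the tree on an input. -/
def Tree.eval {n : ℕ} : Tree n → Cube n → ℤˣ
  | .leaf b, _ => b
  | .node α neg pos, x => if chi α x = -1 then neg.eval x else pos.eval x

/-- The depth: the largest number of queries on a path from the root to a leaf. -/
def Tree.depth {n : ℕ} : Tree n → ℕ
  | .leaf _ => 0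
  | .node _ neg pos => max neg.depth pos.depth + 1

/-- The tree outputs `f x` on every input `x`. -/
def Tree.Computes {n : ℕ} (T : Tree n) (f : BoolFun n) : Prop := ∀ x, T.eval x = f x

/-- Every Boolean function is computed by some tree, so the minimum below is over a
nonempty set. -/
theorem exists_computes {n : ℕ} (f : BoolFun n) : ∃ T : Tree n, T.Computes f := by
  have key : ∀ (s : Finset (Fin n)) (g : BoolFun n),
      (∀ x y : Cube n, (∀ i ∈ s, x i = y i) → g x = g y) → ∃ T : Tree n, T.Computes g := by
    intro s
    induction s using Finset.induction_on with
    | empty =>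
      intro g hg
      exact ⟨.leaf (g 0), fun x => hg 0 x (by simp)⟩
    | insert a s ha ih =>
      intro g hg
      have hdep : ∀ c : ZMod 2, ∃ T : Tree n, T.Computes (fun x => g (Function.update x a c)) := by
        intro c
        apply ih
        intro x y hxy
        apply hg
        intro i hi
        by_cases h : i = a
        · subst h; simp
        · have : i ∈ s := by simpa [h] using hi
          simp [Function.update_of_ne h, hxy i this]
      obtain ⟨T0, h0⟩ := hdep 0
      obtain ⟨T1, h1⟩ := hdep 1
      refine ⟨.node (Pi.single a 1) T1 T0, fun x => ?_⟩
      have hchi : chi (Pi.single a 1) x = (-1 : ℤˣ) ^ (x a) := by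
        simp [chi, Pi.single_apply]
      have hx : x a = 0 ∨ x a = 1 := by
        generalize x a = c
        revert c; decide
      rcases hx with hx | hx
      · have hne : chi (Pi.single a 1) x ≠ -1 := by
          rw [hchi, hx]; decide
        have : Function.update x a 0 = x := by rw [← hx]; simp
        simp only [Tree.eval, if_neg hne]
        exact (h0 x).trans (congrArg g this)
      · have he : chi (Pi.single a 1) x = -1 := by
          rw [hchi, hx]; simp
        have : Function.update x a 1 = x := by rw [← hx]; simp
        simp only [Tree.eval, if_pos he]
        exact (h1 x).trans (congrArg g this)
  exact key Finset.univ f (fun x y h => by rw [funext fun i => h i (Finset.mem_univ i)])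

/-- The parity decision tree complexity: the least depth of a tree that computes `f`. -/
noncomputable def pdt {n : ℕ} (f : BoolFun n) : ℕ :=
  sInf {d : ℕ | ∃ T : Tree n, T.Computes f ∧ T.depth = d}

end PDTree

/-!
A batch of parity queries merges frequencies of the Fourier support `S`: after querying the elements
of `Q`, the restricted function has its Fourier support in the image of `S` under a linear map that
vanishes on `Q` (`exists_linearMap_pdt_le`). If `k = |S|` and `h = k ^ ((1 - ℓ) / 2)`, the point is
to find, for a folding function, a batch of `m` queries that lowers the sparsity by at least a
constant times `m k / h` (`exists_query_batch`). There are two cases.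

* If some class `O_γ` with `γ ≠ 0` has more than `k / h` elements, the single query of `γ` merges
  the two elements of each pair in `O_γ`.
* Otherwise about `2 h` random elements of `S` are queried (`exists_sample`). If `t` and `u` are
  queried and `v = α + t + u` lies in `S`, then `α` is merged with `v`. For fixed `α` such pairs
  `{t, u}` are the edges of a graph on `S`, in which `t` has degree `2 |O_{α+t}| - 2`. Folding gives
  this graph on average of order `k ^ (1 + ℓ)` edges, which makes the expected number of sampled
  edges of constant order, while the degrees are at most `2 k / h`, which makes the variance of
  constant order too. By the second moment method (`sampled_edge_bound`) a constant fraction of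
  the `α` is merged on average, hence for some choice of the queries.

Restrictions of `f` are Boolean functions again, so the folding hypothesis applies to them, and the
step is iterated. By monotonicity `h` can be replaced by its initial value `H`, and a batch that
takes the sparsity from `k` to `k'` uses `O(H (1 - k' / k)) ≤ O(H (log k - log k'))` queries. These
bounds telescope to `O(H log k)` (`pdt_le_add_log`), and `log k ≤ (2 / ε) log H` as `ℓ ≤ 1 - ε`.
-/

namespace PDTree

variable {n : ℕ}

/-! ### Characters and Fourier inversion -/

theorem chi_add_left (α β x : Cube n) : chi (α + β) x = chi α x * chi β x := by
  simp [chi, add_mul, Finset.sum_add_distrib, uzpow_add]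

theorem chi_add_right (α x y : Cube n) : chi α (x + y) = chi α x * chi α y := by
  simp [chi, mul_add, Finset.sum_add_distrib, uzpow_add]

theorem chi_comm (α x : Cube n) : chi α x = chi x α := by
  simp [chi, mul_comm]

theorem chi_zero_left (x : Cube n) : chi 0 x = 1 := by
  simp [chi]

theorem chi_eq_one_or (α x : Cube n) : chi α x = 1 ∨ chi α x = -1 :=
  Int.units_eq_one_or _

theorem exists_chi_eq_neg_one {α : Cube n} (h : α ≠ 0) : ∃ e, chi α e = -1 := by
  obtain ⟨i, hi⟩ := Function.ne_iff.mp h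
  refine ⟨Pi.single i 1, ?_⟩
  have : α i = 1 := by
    have hi' : α i ≠ 0 := hi
    revert hi'
    generalize α i = c
    revert c
    decide
  simp [chi, Pi.single_apply, this]

/-- The character `χ_α` as a real-valued function. -/
def chiR (α x : Cube n) : ℝ := ((chi α x : ℤ) : ℝ)

theorem chiR_add_left (α β x : Cube n) : chiR (α + β) x = chiR α x * chiR β x := by
  simp [chiR, chi_add_left]

theorem chiR_add_right (α x y : Cube n) : chiR α (x + y) = chiR α x * chiR α y := by
  simp [chiR, chi_add_right]

theorem sum_chiR_eq_zero {z : Cube n} (h : z ≠ 0) : ∑ α, chiR α z = 0 := by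
  obtain ⟨e, he⟩ := exists_chi_eq_neg_one h
  have h1 : ∑ α, chiR α z = ∑ α, chiR (α + e) z :=
    (Equiv.sum_comp (Equiv.addRight e) (fun α => chiR α z)).symm
  have h2 : chiR e z = -1 := by simp [chiR, chi_comm e z, he]
  simp only [chiR_add_left, h2, mul_neg, mul_one, Finset.sum_neg_distrib] at h1
  linarith

theorem add_self_cube (x : Cube n) : x + x = 0 := by
  ext i
  exact CharTwo.add_self_eq_zero (x i)

theorem add_add_cancel_cube (x y : Cube n) : x + y + y = x := by
  rw [add_assoc, add_self_cube, add_zero]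

theorem add_eq_zero_cube {x y : Cube n} (h : x + y = 0) : x = y := by
  have := add_add_cancel_cube x y
  rw [h, zero_add] at this
  exact this.symm

/-- Fourier inversion. -/
theorem sum_fourierCoeff_mul_chiR (f : BoolFun n) (x : Cube n) :
    ∑ α, fourierCoeff f α * chiR α x = ((f x : ℤ) : ℝ) := by
  have key : ∀ y : Cube n, ∑ α, chiR α y * chiR α x = if y = x then 2 ^ n else 0 := by
    intro y
    simp only [← chiR_add_right]
    split_ifs with h
    · subst h
      have h1 : ∀ α : Cube n, chiR α (y + y) = 1 := fun α => by
        rw [add_self_cube]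
        simp [chiR, chi]
      simp [h1]
    · exact sum_chiR_eq_zero fun h0 => h (add_eq_zero_cube h0)
  have h1 : ∀ α, fourierCoeff f α * chiR α x =
      (1 / 2 ^ n : ℝ) * ∑ y : Cube n, ((f y : ℤ) : ℝ) * (chiR α y * chiR α x) := by
    intro α
    rw [fourierCoeff, mul_assoc, Finset.sum_mul]
    simp only [chiR, mul_assoc]
  simp only [h1]
  rw [← Finset.mul_sum, Finset.sum_comm]
  simp only [← Finset.mul_sum, key]
  simp only [mul_ite, mul_zero, Finset.sum_ite_eq', Finset.mem_univ, if_true]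
  field_simp

theorem mem_fourierSupport {f : BoolFun n} {α : Cube n} :
    α ∈ fourierSupport f ↔ fourierCoeff f α ≠ 0 := by
  simp [fourierSupport]

theorem sparsity_pos (f : BoolFun n) : 0 < sparsity f := by
  rw [sparsity, Finset.card_pos]
  by_contra h
  rw [Finset.not_nonempty_iff_eq_empty] at h
  have h0 : ∀ α, fourierCoeff f α = 0 := by
    intro α
    by_contra h1
    have := mem_fourierSupport.mpr h1
    simp [h] at this
  have h2 := sum_fourierCoeff_mul_chiR f 0
  simp only [h0, zero_mul, Finset.sum_const_zero] at h2
  rcases Int.units_eq_one_or (f 0) with h3 | h3 <;> simp [h3] at h2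

/-- A function whose Fourier support is at most `{0}` is constant. -/
theorem eq_of_fourierSupport_subset_zero {f : BoolFun n}
    (h : ∀ α ∈ fourierSupport f, α = 0) (x y : Cube n) : f x = f y := by
  have key : ∀ z, ((f z : ℤ) : ℝ) = fourierCoeff f 0 := by
    intro z
    rw [← sum_fourierCoeff_mul_chiR f z, Finset.sum_eq_single 0]
    · simp [chiR, chi_zero_left]
    · intro α _ hα
      by_cases h0 : fourierCoeff f α = 0
      · simp [h0]
      · exact absurd (h α (mem_fourierSupport.mpr h0)) hα
    · simp
  have h1 : ((f x : ℤ) : ℝ) = ((f y : ℤ) : ℝ) := (key x).trans (key y).symm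
  exact Units.ext (by exact_mod_cast h1)

/-! ### Parity queries and the Fourier support -/

theorem pdt_le_iff {f : BoolFun n} {d : ℕ} :
    pdt f ≤ d ↔ ∃ T : Tree n, T.Computes f ∧ T.depth ≤ d := by
  constructor
  · intro h
    have hne : {d : ℕ | ∃ T : Tree n, T.Computes f ∧ T.depth = d}.Nonempty := by
      obtain ⟨T, hT⟩ := exists_computes f
      exact ⟨_, T, hT, rfl⟩
    obtain ⟨T, hT, hd⟩ := Nat.sInf_mem hne
    exact ⟨T, hT, hd.le.trans h⟩
  · rintro ⟨T, hT, hd⟩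
    have hmem : T.depth ∈ {d : ℕ | ∃ T : Tree n, T.Computes f ∧ T.depth = d} := ⟨T, hT, rfl⟩
    exact (Nat.sInf_le hmem).trans hd

theorem pdt_eq_zero_of_fourierSupport {f : BoolFun n}
    (h : ∀ α ∈ fourierSupport f, α = 0) : pdt f = 0 := by
  have h0 : pdt f ≤ 0 := pdt_le_iff.mpr
    ⟨.leaf (f 0), fun x => eq_of_fourierSupport_subset_zero h 0 x, le_rfl⟩
  exact Nat.le_zero.mp h0

/-- The restriction of `f` to the affine hyperplane `χ_α = b`, extended to the whole cube so as to
be invariant under translation by `e`; it is meant for `χ_α(e) = -1`. -/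
def restrict (f : BoolFun n) (α e : Cube n) (b : ℤˣ) : BoolFun n :=
  fun x => if chi α x = b then f x else f (x + e)

/-- The projection `β ↦ β + (β · e) α`, with kernel spanned by `α` when `α · e = 1`. -/
def project (α e : Cube n) : Cube n →ₗ[ZMod 2] Cube n where
  toFun β := β + (∑ i, β i * e i) • α
  map_add' β γ := by
    simp only [Pi.add_apply, add_mul, Finset.sum_add_distrib, add_smul]
    abel
  map_smul' c β := by
    simp only [Pi.smul_apply, smul_eq_mul, mul_assoc, ← Finset.mul_sum, smul_add, mul_smul,
      RingHom.id_apply]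

theorem project_apply_of_chi_eq_one {α e β : Cube n} (h : chi β e = 1) :
    project α e β = β := by
  have : (∑ i, β i * e i : ZMod 2) = 0 := by
    rw [chi] at h
    revert h
    generalize (∑ i, β i * e i : ZMod 2) = c
    revert c
    decide
  change β + (∑ i, β i * e i : ZMod 2) • α = β
  rw [this, zero_smul, add_zero]

theorem project_apply_of_chi_eq_neg_one {α e β : Cube n} (h : chi β e = -1) :
    project α e β = β + α := by
  have : (∑ i, β i * e i : ZMod 2) = 1 := by
    rw [chi] at h
    revert h
    generalize (∑ i, β i * e i : ZMod 2) = c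
    revert c
    decide
  change β + (∑ i, β i * e i : ZMod 2) • α = β + α
  rw [this, one_smul]

/-- After a query of `χ_α` the Fourier support is contained in the image of the old one
under `project α e`: frequencies that differ by `α` are merged. -/
theorem fourierSupport_restrict (f : BoolFun n) {α e : Cube n} (he : chi α e = -1) (b : ℤˣ)
    {β : Cube n} (hβ : β ∈ fourierSupport (restrict f α e b)) :
    ∃ β' ∈ fourierSupport f, project α e β' = β := by
  rw [mem_fourierSupport] at hβ
  set g := restrict f α e b with hg
  have hχα : ∀ x, chi α (x + e) = -chi α x := by
    intro x; rw [chi_add_right, he]; simp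
  have hee : ∀ x : Cube n, x + e + e = x := fun x => add_add_cancel_cube x e
  have hinv : ∀ x, g (x + e) = g x := by
    intro x
    simp only [hg, restrict, hχα, hee]
    rcases chi_eq_one_or α x with h | h <;> rcases Int.units_eq_one_or b with h' | h' <;>
      simp [h, h']
  have hshift : ∀ F : Cube n → ℝ, ∑ x, F (x + e) = ∑ x, F x := fun F =>
    Equiv.sum_comp (Equiv.addRight e) F
  have hcoeff : ∀ (u : BoolFun n) (δ : Cube n),
      fourierCoeff u δ = (1 / 2 ^ n : ℝ) * ∑ x, ((u x : ℤ) : ℝ) * chiR δ x := fun _ _ => rfl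
  have hβe : chi β e = 1 := by
    rcases chi_eq_one_or β e with h | h
    · exact h
    · exfalso
      apply hβ
      have h1 := hshift (fun x => ((g x : ℤ) : ℝ) * chiR β x)
      have h2 : chiR β e = -1 := by simp [chiR, h]
      simp only [hinv, chiR_add_right, h2, mul_neg, mul_one, Finset.sum_neg_distrib] at h1
      rw [hcoeff, show ∑ x, ((g x : ℤ) : ℝ) * chiR β x = 0 by linarith, mul_zero]
  have hβeR : chiR β e = 1 := by simp [chiR, hβe]
  have hαeR : chiR α e = -1 := by simp [chiR, he]
  set bR : ℝ := ((b : ℤ) : ℝ) with hbR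
  have hpt : ∀ x, 2 * ((g x : ℤ) : ℝ) = ((f x : ℤ) : ℝ) * (1 + bR * chiR α x) +
      ((f (x + e) : ℤ) : ℝ) * (1 + bR * chiR α (x + e)) := by
    intro x
    rw [chiR_add_right, hαeR]
    rcases chi_eq_one_or α x with h | h <;> rcases Int.units_eq_one_or b with h' | h' <;>
      simp [hg, restrict, h, h', hbR, chiR] <;> ring
  have hsum : ∑ x, ((g x : ℤ) : ℝ) * chiR β x =
      ∑ x, ((f x : ℤ) : ℝ) * chiR β x + bR * ∑ x, ((f x : ℤ) : ℝ) * chiR (β + α) x := by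
    have h1 := hshift (fun x => ((f x : ℤ) : ℝ) * (1 + bR * chiR α x) * chiR β x)
    have h2 : ∑ x, (2 * ((g x : ℤ) : ℝ)) * chiR β x =
        ∑ x, ((f x : ℤ) : ℝ) * (1 + bR * chiR α x) * chiR β x +
        ∑ x, ((f (x + e) : ℤ) : ℝ) * (1 + bR * chiR α (x + e)) * chiR β (x + e) := by
      rw [← Finset.sum_add_distrib]
      refine Finset.sum_congr rfl fun x _ => ?_
      rw [hpt x, chiR_add_right β, hβeR]
      ring
    rw [h1] at h2
    have h3 : ∑ x, ((f x : ℤ) : ℝ) * (1 + bR * chiR α x) * chiR β x =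
        ∑ x, ((f x : ℤ) : ℝ) * chiR β x + bR * ∑ x, ((f x : ℤ) : ℝ) * chiR (β + α) x := by
      rw [Finset.mul_sum, ← Finset.sum_add_distrib]
      refine Finset.sum_congr rfl fun x _ => ?_
      rw [chiR_add_left]
      ring
    have h4 : ∑ x, (2 * ((g x : ℤ) : ℝ)) * chiR β x = 2 * ∑ x, ((g x : ℤ) : ℝ) * chiR β x := by
      rw [Finset.mul_sum]
      exact Finset.sum_congr rfl fun x _ => by ring
    linarith
  have hgf : fourierCoeff g β = fourierCoeff f β + bR * fourierCoeff f (β + α) := by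
    rw [hcoeff, hcoeff, hcoeff, hsum]
    ring
  by_cases h0 : fourierCoeff f β = 0
  · refine ⟨β + α, mem_fourierSupport.mpr fun h1 => hβ ?_, ?_⟩
    · rw [hgf, h0, h1]; simp
    · rw [project_apply_of_chi_eq_neg_one (by rw [chi_add_left, hβe, he]; simp)]
      exact add_add_cancel_cube β α
  · exact ⟨β, mem_fourierSupport.mpr h0, project_apply_of_chi_eq_one hβe⟩

theorem pdt_le_of_restrict (f : BoolFun n) {α e : Cube n} {d : ℕ}
    (h : ∀ b, pdt (restrict f α e b) ≤ d) : pdt f ≤ d + 1 := by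
  obtain ⟨T1, hT1, hd1⟩ := pdt_le_iff.mp (h 1)
  obtain ⟨T2, hT2, hd2⟩ := pdt_le_iff.mp (h (-1))
  refine pdt_le_iff.mpr ⟨.node α T2 T1, fun x => ?_, by simp [Tree.depth, hd1, hd2]⟩
  rcases chi_eq_one_or α x with hx | hx
  · have : chi α x ≠ -1 := by rw [hx]; decide
    rw [Tree.eval, if_neg this, hT1 x, restrict, if_pos hx]
  · rw [Tree.eval, if_pos hx, hT2 x, restrict, if_pos hx]

/-- Non-adaptive queries of the parities in `Q`: the Fourier support is mapped by a linear
map that vanishes on `Q`. -/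
theorem exists_linearMap_pdt_le (Q : List (Cube n)) :
    ∃ L : Cube n →ₗ[ZMod 2] Cube n, (∀ t ∈ Q, L t = 0) ∧
      ∀ (f : BoolFun n) (d : ℕ),
        (∀ g : BoolFun n, (∀ β ∈ fourierSupport g, ∃ β' ∈ fourierSupport f, L β' = β) →
          pdt g ≤ d) → pdt f ≤ d + Q.length := by
  induction Q with
  | nil => exact ⟨LinearMap.id, by simp, fun f d h => h f fun β hβ => ⟨β, hβ, rfl⟩⟩
  | cons t Q ih =>
    obtain ⟨L, hL, hd⟩ := ih
    by_cases h0 : L t = 0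
    · refine ⟨L, by simpa [h0] using hL, fun f d h => ?_⟩
      have := hd f d h
      simp only [List.length_cons]
      omega
    · obtain ⟨e, he⟩ := exists_chi_eq_neg_one h0
      refine ⟨(project (L t) e).comp L, ?_, fun f d h => ?_⟩
      · intro s hs
        rcases List.mem_cons.mp hs with rfl | hs
        · rw [LinearMap.comp_apply, project_apply_of_chi_eq_neg_one he, add_self_cube]
        · rw [LinearMap.comp_apply, hL s hs, map_zero]
      · have := hd f (d + 1) fun g hg => pdt_le_of_restrict g (α := L t) (e := e) fun b => h _ ?_
        · simp only [List.length_cons]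
          omega
        · intro β hβ
          obtain ⟨β₁, h₁, rfl⟩ := fourierSupport_restrict g he b hβ
          obtain ⟨β₂, h₂, rfl⟩ := hg β₁ h₁
          exact ⟨β₂, h₂, rfl⟩

/-- Querying the whole Fourier support leaves a constant function. -/
theorem pdt_le_sparsity (f : BoolFun n) : pdt f ≤ sparsity f := by
  obtain ⟨L, hL, hd⟩ := exists_linearMap_pdt_le (fourierSupport f).toList
  have := hd f 0 fun g hg => (pdt_eq_zero_of_fourierSupport fun α hα => ?_).le
  · simpa [sparsity] using this
  · obtain ⟨β, hβ, rfl⟩ := hg α hα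
    exact hL β (by simpa using hβ)

/-- A map that merges each element of `B ⊆ S` with another element of `S` has at most
`|S| - |B| / 2` values on `S`. -/
theorem two_mul_card_image_add_card_le {α β : Type*} [DecidableEq α] [DecidableEq β]
    (S B : Finset α) (L : α → β) (hBS : B ⊆ S)
    (hB : ∀ a ∈ B, ∃ v ∈ S, v ≠ a ∧ L v = L a) : 2 * (S.image L).card + B.card ≤ 2 * S.card := by
  have h1 : S.card = ∑ y ∈ S.image L, (S.filter (fun a => L a = y)).card :=
    Finset.card_eq_sum_card_fiberwise fun a ha => Finset.mem_image_of_mem L ha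
  have h2 : B.card = ∑ y ∈ S.image L, (B.filter (fun a => L a = y)).card :=
    Finset.card_eq_sum_card_fiberwise fun a ha => Finset.mem_image_of_mem L (hBS ha)
  have h3 : (S.image L).card = ∑ y ∈ S.image L, 1 := by simp
  rw [h1, h2, h3, Finset.mul_sum, Finset.mul_sum, ← Finset.sum_add_distrib]
  refine Finset.sum_le_sum fun y hy => ?_
  have hsub : B.filter (fun a => L a = y) ⊆ S.filter (fun a => L a = y) :=
    Finset.filter_subset_filter _ hBS
  have hle := Finset.card_le_card hsub
  obtain ⟨a, ha, hay⟩ := Finset.mem_image.mp hy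
  have hpos : 0 < (S.filter (fun a => L a = y)).card :=
    Finset.card_pos.mpr ⟨a, by simp [ha, hay]⟩
  rcases (B.filter (fun a => L a = y)).eq_empty_or_nonempty with h0 | ⟨a, ha⟩
  · rw [h0, Finset.card_empty]
    omega
  · obtain ⟨haB, haL⟩ := Finset.mem_filter.mp ha
    obtain ⟨v, hv, hva, hvL⟩ := hB a haB
    have : 1 < (S.filter (fun a => L a = y)).card :=
      Finset.one_lt_card.mpr ⟨v, by simp [hv, hvL, haL], a, by simp [hBS haB, haL], hva⟩
    omega

open Classical in
/-- If a linear map that vanishes on the queried parities must merge each frequency in `B` with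
another one, then the queries reduce the sparsity by at least `|B| / 2`. -/
theorem pdt_le_of_merge (f : BoolFun n) (Q : List (Cube n)) (B : Finset (Cube n))
    (hBS : B ⊆ fourierSupport f)
    (hB : ∀ a ∈ B, ∀ L : Cube n →ₗ[ZMod 2] Cube n, (∀ t ∈ Q, L t = 0) →
      ∃ v ∈ fourierSupport f, v ≠ a ∧ L v = L a) {d : ℕ}
    (hd : ∀ g : BoolFun n, 2 * sparsity g + B.card ≤ 2 * sparsity f → pdt g ≤ d) :
    pdt f ≤ d + Q.length := by
  obtain ⟨L, hL, hLd⟩ := exists_linearMap_pdt_le Q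
  refine hLd f d fun g hg => hd g ?_
  have h1 := two_mul_card_image_add_card_le (fourierSupport f) B L hBS fun a ha => hB a ha L hL
  have h2 : sparsity g ≤ ((fourierSupport f).image L).card :=
    Finset.card_le_card fun β hβ => by simpa using hg β hβ
  simp only [sparsity] at *
  omega

/-! ### A second moment bound for random sets of vertices -/

theorem sum_fun_succ {ι : Type*} [Fintype ι] [DecidableEq ι] (q : ℕ) (F : (Fin (q + 1) → ι) → ℝ) :
    ∑ τ, F τ = ∑ a, ∑ τ : Fin q → ι, F (Fin.cons a τ) := by
  rw [← (Fin.consEquiv (fun _ : Fin (q + 1) => ι)).sum_comp, Fintype.sum_prod_type]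
  rfl

/-- The first moment of a sum of `q` independent uniform samples. -/
theorem sum_sample {ι : Type*} [Fintype ι] [DecidableEq ι] [Nonempty ι] (φ : ι → ℝ) (q : ℕ) :
    ∑ τ : Fin q → ι, ∑ i, φ (τ i) =
      (Fintype.card ι : ℝ) ^ q * (q * ((∑ a, φ a) / Fintype.card ι)) := by
  have hk : (Fintype.card ι : ℝ) ≠ 0 := by exact_mod_cast Fintype.card_ne_zero
  induction q with
  | zero => simp
  | succ q ih =>
    rw [sum_fun_succ]
    simp only [Fin.sum_univ_succ, Fin.cons_zero, Fin.cons_succ, Finset.sum_add_distrib, ih,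
      Finset.sum_const, Finset.card_univ, Fintype.card_fun, Fintype.card_fin, nsmul_eq_mul,
      ← Finset.mul_sum]
    push_cast
    field_simp
    ring

/-- The second moment of a sum of `q` independent uniform samples. -/
theorem sum_sample_sq_le {ι : Type*} [Fintype ι] [DecidableEq ι] [Nonempty ι] (φ : ι → ℝ)
    (q : ℕ) :
    ∑ τ : Fin q → ι, (∑ i, φ (τ i)) ^ 2 ≤
      (Fintype.card ι : ℝ) ^ q * (q * ((∑ a, φ a ^ 2) / Fintype.card ι) +
        q ^ 2 * ((∑ a, φ a) / Fintype.card ι) ^ 2) := by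
  have hk : (Fintype.card ι : ℝ) ≠ 0 := by exact_mod_cast Fintype.card_ne_zero
  have key : ∑ τ : Fin q → ι, (∑ i, φ (τ i)) ^ 2 =
      (Fintype.card ι : ℝ) ^ q * (q * ((∑ a, φ a ^ 2) / Fintype.card ι) +
        q * (q - 1) * ((∑ a, φ a) / Fintype.card ι) ^ 2) := by
    induction q with
    | zero => simp
    | succ q ih =>
      rw [sum_fun_succ]
      have hs := sum_sample φ q
      simp only [Fin.sum_univ_succ, Fin.cons_zero, Fin.cons_succ, add_sq, Finset.sum_add_distrib,
        ih, Finset.sum_const, Finset.card_univ, Fintype.card_fun, Fintype.card_fin, nsmul_eq_mul,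
        ← Finset.mul_sum, hs, ← Finset.sum_mul]
      push_cast
      field_simp
      ring
  rw [key]
  gcongr
  nlinarith [(Nat.cast_nonneg q : (0 : ℝ) ≤ q)]

/-- The conclusion of the second moment method from `W x = ∑ X` and the Cauchy-Schwarz bound, where
`W` is the number of outcomes and `N` the number of those with `X ≠ 0`; the resulting bound
`x / (x + 2 z + 1)` is monotone in `x`. -/
theorem le_of_secondMoment {W x y z N : ℝ} (hW : 0 < W) (hz : 0 ≤ z) (hN : 0 ≤ N) (hy : 0 ≤ y)
    (hyx : y ≤ x) (h : (W * x) ^ 2 ≤ N * (W * (x ^ 2 + x * (2 * z) + x))) :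
    W * y ≤ (y + 2 * z + 1) * N := by
  rcases (hy.trans hyx).eq_or_lt with h0 | hx
  · have : y = 0 := le_antisymm (by rw [h0]; exact hyx) hy
    rw [this, mul_zero]
    positivity
  · have h1 : W * x ≤ N * (x + 2 * z + 1) := by
      have h2 : (W * x) * (W * x) ≤ (W * x) * (N * (x + 2 * z + 1)) := by linarith
      exact le_of_mul_le_mul_left h2 (by positivity)
    have h2 : 0 ≤ W * ((x - y) * (2 * z + 1)) := by
      have : 0 ≤ x - y := by linarith
      positivity
    have h3 : (W * x) * (y + 2 * z + 1) ≤ N * (x + 2 * z + 1) * (y + 2 * z + 1) := by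
      gcongr
    have h4 : (W * y) * (x + 2 * z + 1) ≤ ((y + 2 * z + 1) * N) * (x + 2 * z + 1) := by
      linarith
    exact le_of_mul_le_mul_right h4 (by positivity)

open Classical in
/-- Let `R` be a symmetric relation on `k` points in which every point has at most `D` neighbours,
with `E` ordered related pairs. Among the pairs of `q`-tuples of points, at least the fraction
`x / (x + 2 q D / k + 1)`, where `x = q² E / k²`, has a related pair across. -/
theorem sampled_edge_bound {ι : Type*} [Fintype ι] [Nonempty ι] (R : ι → ι → Prop)
    [∀ a, DecidablePred (R a)] (hR : ∀ a b, R a b → R b a) (D : ℝ)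
    (hD : ∀ a, ((Finset.univ.filter (R a)).card : ℝ) ≤ D) (q : ℕ)
    [DecidablePred fun p : (Fin q → ι) × (Fin q → ι) => ∃ i j, R (p.1 i) (p.2 j)]
    {y : ℝ} (hy0 : 0 ≤ y)
    (hy : y ≤ (q : ℝ) ^ 2 * (∑ a, ((Finset.univ.filter (R a)).card : ℝ)) /
      (Fintype.card ι : ℝ) ^ 2) :
    (Fintype.card ι : ℝ) ^ q * (Fintype.card ι : ℝ) ^ q * y ≤
      (y + 2 * (q * D / Fintype.card ι) + 1) *
        ((Finset.univ.filter (fun p : (Fin q → ι) × (Fin q → ι) =>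
          ∃ i j, R (p.1 i) (p.2 j))).card : ℝ) := by
  set k : ℝ := (Fintype.card ι : ℝ) with hk
  have hk0 : 0 < k := by rw [hk]; exact_mod_cast Fintype.card_pos
  set A : ι → ι → ℝ := fun a b => if R a b then 1 else 0 with hA
  have hAsymm : ∀ a b, A a b = A b a := fun a b => by
    simp only [hA]
    exact if_congr ⟨hR a b, hR b a⟩ rfl rfl
  have hA2 : ∀ a b, A a b ^ 2 = A a b := fun a b => by simp only [hA]; split_ifs <;> simp
  set deg : ι → ℝ := fun a => ((Finset.univ.filter (R a)).card : ℝ) with hdeg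
  have hrow : ∀ a, ∑ b, A a b = deg a := fun a => by simp only [hA, hdeg, Finset.sum_boole]
  have hcol : ∀ b, ∑ a, A a b = deg b := fun b => by simp only [hAsymm _ b, hrow]
  have hdeg0 : ∀ a, 0 ≤ deg a := fun a => Nat.cast_nonneg _
  set E : ℝ := ∑ a, deg a with hE
  have hE0 : 0 ≤ E := Finset.sum_nonneg fun a _ => hdeg0 a
  set x : ℝ := (q : ℝ) ^ 2 * E / k ^ 2 with hx
  have hx0 : 0 ≤ x := div_nonneg (mul_nonneg (sq_nonneg _) hE0) (sq_nonneg _)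
  have hD0 : 0 ≤ D := (hdeg0 (Classical.arbitrary ι)).trans (hD _)
  have hdegsq : ∑ a, deg a ^ 2 ≤ D * E := by
    rw [hE, Finset.mul_sum]
    refine Finset.sum_le_sum fun a _ => ?_
    rw [sq]
    exact mul_le_mul_of_nonneg_right (hD a) (hdeg0 a)
  set M : ℝ := k ^ q with hM
  have hM0 : 0 < M := by positivity
  set X : (Fin q → ι) × (Fin q → ι) → ℝ := fun p => ∑ i, ∑ j, A (p.1 i) (p.2 j) with hX
  set H := Finset.univ.filter (fun p : (Fin q → ι) × (Fin q → ι) =>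
          ∃ i j, R (p.1 i) (p.2 j)) with hH
  -- first moment
  have hmean : ∑ p, X p = M * M * x := by
    rw [Fintype.sum_prod_type_right]
    have h1 : ∀ σ : Fin q → ι, ∑ τ : Fin q → ι, X (τ, σ) =
        M * (q * ((∑ j, deg (σ j)) / k)) := by
      intro σ
      have h2 := sum_sample (fun a => ∑ j, A a (σ j)) q
      simp only [hX]
      rw [h2, Finset.sum_comm]
      simp only [hcol, ← hk, ← hM]
    simp only [h1]
    rw [← Finset.mul_sum, ← Finset.mul_sum, ← Finset.sum_div, sum_sample deg q]
    rw [← hk, ← hM, ← hE, hx]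
    field_simp
  -- second moment
  have hsq : ∑ p, X p ^ 2 ≤ M * M * (x ^ 2 + x * (2 * (q * D / k)) + x) := by
    rw [Fintype.sum_prod_type_right]
    have h1 : ∀ σ : Fin q → ι, ∑ τ : Fin q → ι, X (τ, σ) ^ 2 ≤
        M * (q * ((∑ a, (∑ j, A a (σ j)) ^ 2) / k) +
          q ^ 2 * ((∑ j, deg (σ j)) / k) ^ 2) := by
      intro σ
      have h2 := sum_sample_sq_le (fun a => ∑ j, A a (σ j)) q
      have h3 : ∑ a, ∑ j, A a (σ j) = ∑ j, deg (σ j) := by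
        rw [Finset.sum_comm]
        simp only [hcol]
      rw [h3] at h2
      exact h2
    have h4 : ∑ σ : Fin q → ι, ∑ a, (∑ j, A a (σ j)) ^ 2 ≤
        M * (q * (E / k) + q ^ 2 * (D * E / k ^ 2)) := by
      rw [Finset.sum_comm]
      have h5 : ∀ a, ∑ σ : Fin q → ι, (∑ j, A a (σ j)) ^ 2 ≤
          M * (q * (deg a / k) + q ^ 2 * (deg a / k) ^ 2) := by
        intro a
        have h6 := sum_sample_sq_le (fun b => A a b) q
        simp only [hA2, hrow] at h6
        exact h6
      refine (Finset.sum_le_sum fun a _ => h5 a).trans ?_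
      rw [← Finset.mul_sum, Finset.sum_add_distrib, ← Finset.mul_sum, ← Finset.mul_sum,
        ← Finset.sum_div]
      simp only [div_pow]
      rw [← Finset.sum_div]
      gcongr
    have h7 : ∑ σ : Fin q → ι, (∑ j, deg (σ j)) ^ 2 ≤
        M * (q * (D * E / k) + q ^ 2 * (E / k) ^ 2) := by
      refine (sum_sample_sq_le deg q).trans ?_
      rw [← hk, ← hM, ← hE]
      gcongr
    calc ∑ σ : Fin q → ι, ∑ τ : Fin q → ι, X (τ, σ) ^ 2
        ≤ ∑ σ : Fin q → ι, M * (q * ((∑ a, (∑ j, A a (σ j)) ^ 2) / k) +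
          q ^ 2 * ((∑ j, deg (σ j)) / k) ^ 2) := Finset.sum_le_sum fun σ _ => h1 σ
      _ = M * (q * ((∑ σ : Fin q → ι, ∑ a, (∑ j, A a (σ j)) ^ 2) / k) +
          q ^ 2 * ((∑ σ : Fin q → ι, (∑ j, deg (σ j)) ^ 2) / k ^ 2)) := by
        simp only [div_pow]
        rw [← Finset.mul_sum, Finset.sum_add_distrib, ← Finset.mul_sum, ← Finset.mul_sum,
          ← Finset.sum_div, ← Finset.sum_div]
      _ ≤ M * (q * ((M * (q * (E / k) + q ^ 2 * (D * E / k ^ 2))) / k) +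
          q ^ 2 * ((M * (q * (D * E / k) + q ^ 2 * (E / k) ^ 2)) / k ^ 2)) := by gcongr
      _ = M * M * (x ^ 2 + x * (2 * (q * D / k)) + x) := by
        rw [hx]
        field_simp
        ring
  -- Cauchy-Schwarz on the set where `X` does not vanish
  have hsupp : ∑ p, X p = ∑ p ∈ H, X p := by
    symm
    apply Finset.sum_subset (Finset.subset_univ _)
    intro p _ hp
    simp only [hH, Finset.mem_filter, Finset.mem_univ, true_and, not_exists] at hp
    simp [hX, hA, hp]
  have hCS : (M * M * x) ^ 2 ≤ H.card * (M * M * (x ^ 2 + x * (2 * (q * D / k)) + x)) := by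
    rw [← hmean, hsupp]
    refine sq_sum_le_card_mul_sum_sq.trans ?_
    gcongr
    exact (Finset.sum_le_sum_of_subset_of_nonneg (Finset.subset_univ _)
      fun _ _ _ => sq_nonneg _).trans hsq
  have hz : 0 ≤ q * D / k := div_nonneg (mul_nonneg (Nat.cast_nonneg q) hD0) hk0.le
  exact le_of_secondMoment (mul_pos hM0 hM0) hz (Nat.cast_nonneg _) hy0 hy hCS

/-! ### Folding in terms of ordered pairs -/

open Classical in
/-- The frequencies `α` of the Fourier support with `α + γ` again in the Fourier support. For
`γ ≠ 0` these are the elements of the pairs in `foldClass f γ`. -/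
noncomputable def foldSet (f : BoolFun n) (γ : Cube n) : Finset (Cube n) :=
  (fourierSupport f).filter (fun α => α + γ ∈ fourierSupport f)

theorem mem_foldSet {f : BoolFun n} {γ α : Cube n} :
    α ∈ foldSet f γ ↔ α ∈ fourierSupport f ∧ α + γ ∈ fourierSupport f := by
  simp [foldSet]

theorem add_ne_self_cube {α γ : Cube n} (h : γ ≠ 0) : α + γ ≠ α := by
  simpa using h

theorem add_add_self_cube (x y : Cube n) : x + (x + y) = y := by
  rw [← add_assoc, add_self_cube, zero_add]

open Classical in
theorem card_foldSet (f : BoolFun n) {γ : Cube n} (hγ : γ ≠ 0) :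
    (foldSet f γ).card = 2 * (foldClass f γ).card := by
  have hmaps : ∀ α ∈ foldSet f γ, ({α, α + γ} : Finset (Cube n)) ∈ foldClass f γ := by
    intro α hα
    obtain ⟨h1, h2⟩ := mem_foldSet.mp hα
    have hne : α ≠ α + γ := (add_ne_self_cube hγ).symm
    rw [foldClass, Finset.mem_filter, Finset.mem_powersetCard]
    refine ⟨⟨?_, Finset.card_pair hne⟩, ?_⟩
    · intro x hx
      rcases Finset.mem_insert.mp hx with rfl | hx
      · exact h1
      · rw [Finset.mem_singleton.mp hx]
        exact h2
    · rw [Finset.sum_pair hne, add_add_self_cube]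
  rw [Finset.card_eq_sum_card_fiberwise hmaps, mul_comm, ← smul_eq_mul, ← Finset.sum_const]
  refine Finset.sum_congr rfl fun P hP => ?_
  rw [foldClass, Finset.mem_filter, Finset.mem_powersetCard] at hP
  obtain ⟨⟨hPS, hP2⟩, hsum⟩ := hP
  refine Eq.trans (congrArg Finset.card ?_) hP2
  obtain ⟨a, b, hab, rfl⟩ := Finset.card_eq_two.mp hP2
  rw [Finset.sum_pair hab] at hsum
  have ha : a ∈ fourierSupport f := hPS (by simp)
  have hb : b ∈ fourierSupport f := hPS (by simp)
  have hag : a + γ = b := by rw [← hsum, add_add_self_cube]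
  have hbg : b + γ = a := by rw [← hsum, add_comm a b, add_add_self_cube]
  ext x
  rw [Finset.mem_filter, mem_foldSet]
  constructor
  · rintro ⟨-, h⟩
    rw [← h]
    simp
  · intro hx
    rcases Finset.mem_insert.mp hx with rfl | hx
    · exact ⟨⟨ha, hag ▸ hb⟩, by rw [hag]⟩
    · rw [Finset.mem_singleton.mp hx]
      exact ⟨⟨hb, hbg ▸ ha⟩, by rw [hbg, Finset.pair_comm]⟩

theorem two_mul_card_filter_powersetCard_two_le {α : Type*} [DecidableEq α] (S : Finset α)
    (p : Finset α → Prop) [DecidablePred p] :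
    2 * ((S.powersetCard 2).filter p).card ≤
      ∑ a ∈ S, (S.filter (fun b => b ≠ a ∧ p {a, b})).card := by
  rw [← Finset.card_sigma]
  set U := S.sigma fun a => S.filter (fun b => b ≠ a ∧ p {a, b}) with hU
  have hmem : ∀ a b, (⟨a, b⟩ : Σ _ : α, α) ∈ U ↔ a ∈ S ∧ b ∈ S ∧ b ≠ a ∧ p {a, b} := by
    intro a b
    simp [hU]
  have hmaps : ∀ x ∈ U, ({x.1, x.2} : Finset α) ∈ (S.powersetCard 2).filter p := by
    rintro ⟨a, b⟩ hx
    obtain ⟨ha, hb, hne, hp⟩ := (hmem a b).mp hx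
    rw [Finset.mem_filter, Finset.mem_powersetCard]
    refine ⟨⟨?_, Finset.card_pair hne.symm⟩, hp⟩
    intro y hy
    rcases Finset.mem_insert.mp hy with rfl | hy
    · exact ha
    · rw [Finset.mem_singleton.mp hy]
      exact hb
  rw [Finset.card_eq_sum_card_fiberwise hmaps, mul_comm, ← smul_eq_mul, ← Finset.sum_const]
  refine Finset.sum_le_sum fun P hP => ?_
  rw [Finset.mem_filter, Finset.mem_powersetCard] at hP
  obtain ⟨⟨hPS, hP2⟩, hp⟩ := hP
  obtain ⟨a, b, hab, rfl⟩ := Finset.card_eq_two.mp hP2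
  have ha : a ∈ S := hPS (by simp)
  have hb : b ∈ S := hPS (by simp)
  have hne : (⟨a, b⟩ : Σ _ : α, α) ≠ ⟨b, a⟩ := fun h => hab (congrArg Sigma.fst h)
  rw [← Finset.card_pair hne]
  refine Finset.card_le_card fun x hx => ?_
  rcases Finset.mem_insert.mp hx with rfl | hx
  · exact Finset.mem_filter.mpr ⟨(hmem a b).mpr ⟨ha, hb, hab.symm, hp⟩, rfl⟩
  · rw [Finset.mem_singleton.mp hx]
    exact Finset.mem_filter.mpr ⟨(hmem b a).mpr ⟨hb, ha, hab, by rwa [Finset.pair_comm]⟩,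
      Finset.pair_comm b a⟩

open Classical in
/-- The frequencies `t ≠ α` for which the pair `{α, t}` is folding at exponent `ℓ`. -/
noncomputable def foldPartners (f : BoolFun n) (ℓ : ℝ) (α : Cube n) : Finset (Cube n) :=
  (fourierSupport f).filter (fun t => t ≠ α ∧
    2 * ((sparsity f : ℝ) ^ ℓ + 1) ≤ ((foldSet f (α + t)).card : ℝ))

theorem foldPartners_subset (f : BoolFun n) (ℓ : ℝ) (α : Cube n) :
    foldPartners f ℓ α ⊆ fourierSupport f :=
  Finset.filter_subset _ _

theorem IsFolding.le_sum_card_foldPartners {f : BoolFun n} {δ ℓ : ℝ} (h : IsFolding δ ℓ f) :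
    δ * ((sparsity f : ℝ) * (sparsity f - 1)) ≤
      ∑ α ∈ fourierSupport f, ((foldPartners f ℓ α).card : ℝ) := by
  have h1 : 2 * (((fourierSupport f).powersetCard 2).filter (fun P =>
      (sparsity f : ℝ) ^ ℓ + 1 ≤ ((foldClass f (∑ α ∈ P, α)).card : ℝ))).card ≤
        ∑ α ∈ fourierSupport f, (foldPartners f ℓ α).card := by
    refine (two_mul_card_filter_powersetCard_two_le _ _).trans_eq
      (Finset.sum_congr rfl fun α _ => congrArg Finset.card (Finset.ext fun t => ?_))
    rw [foldPartners, Finset.mem_filter, Finset.mem_filter]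
    refine and_congr_right fun _ => and_congr_right fun hne => ?_
    have h0 : α + t ≠ 0 := fun h0 => hne (add_eq_zero_cube h0).symm
    rw [Finset.sum_pair hne.symm, card_foldSet f h0, Nat.cast_mul, Nat.cast_ofNat,
      mul_le_mul_iff_right₀ two_pos]
  have h3 := (Nat.cast_le (α := ℝ)).mpr h1
  push_cast at h3
  rw [IsFolding, Nat.cast_choose_two] at h
  linarith

/-! ### Batches of queries that shrink the Fourier support -/

theorem pdt_le_of_foldSet (f : BoolFun n) {γ : Cube n} (hγ : γ ≠ 0) {d : ℕ}
    (hd : ∀ g : BoolFun n, 2 * sparsity g + (foldSet f γ).card ≤ 2 * sparsity f → pdt g ≤ d) :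
    pdt f ≤ d + 1 := by
  refine pdt_le_of_merge f [γ] (foldSet f γ) (fun a ha => (mem_foldSet.mp ha).1) ?_ hd
  intro a ha L hL
  refine ⟨a + γ, (mem_foldSet.mp ha).2, add_ne_self_cube hγ, ?_⟩
  rw [map_add, hL γ (by simp), add_zero]

open Classical in
/-- If no nonzero `γ` has a large fold set, some `2 q` elements of the Fourier support are such
that querying them merges a constant fraction of the Fourier support: `α` is merged with
`α + t + u` as soon as `t` and `u` are queried and `α + t + u` is in the support. -/
theorem exists_sample (f : BoolFun n) {δ ℓ h : ℝ} {q : ℕ} (hk : 2 ≤ sparsity f) (hδ : 0 ≤ δ)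
    (hf : IsFolding δ ℓ f) (hh : 1 ≤ h) (hhl : h ^ 2 = (sparsity f : ℝ) ^ (1 - ℓ)) (hq : h ≤ q)
    (hq2 : (q : ℝ) ≤ 2 * h)
    (hD : ∀ γ, γ ≠ 0 → ((foldSet f γ).card : ℝ) ≤ 2 * sparsity f / h) :
    ∃ Q : List (Cube n), Q.length = 2 * q ∧ ∃ B ⊆ fourierSupport f,
      δ * sparsity f ≤ 11 * (B.card : ℝ) ∧
      ∀ a ∈ B, ∀ L : Cube n →ₗ[ZMod 2] Cube n, (∀ t ∈ Q, L t = 0) →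
        ∃ v ∈ fourierSupport f, v ≠ a ∧ L v = L a := by
  set S := fourierSupport f with hS
  let ι := {x // x ∈ S}
  have hcard : Fintype.card ι = sparsity f := Fintype.card_coe S
  have : Nonempty ι := Fintype.card_pos_iff.mp (by rw [hcard]; omega)
  set k : ℝ := (sparsity f : ℝ) with hkdef
  have hk2 : (2 : ℝ) ≤ k := by rw [hkdef]; exact_mod_cast hk
  have hk0 : 0 < k := by linarith
  have hh0 : 0 < h := by linarith
  clear_value k
  obtain ⟨R, hR⟩ : ∃ R : Cube n → ι → ι → Prop, ∀ α t u,
      R α t u ↔ t.1 ≠ α ∧ u.1 ≠ α ∧ t ≠ u ∧ α + t.1 + u.1 ∈ S :=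
    ⟨fun α t u => t.1 ≠ α ∧ u.1 ≠ α ∧ t ≠ u ∧ α + t.1 + u.1 ∈ S, fun _ _ _ => Iff.rfl⟩
  have hRsymm : ∀ α t u, R α t u → R α u t := by
    intro α t u htu
    obtain ⟨h1, h2, h3, h4⟩ := (hR α t u).mp htu
    exact (hR α u t).mpr ⟨h2, h1, h3.symm, by rwa [add_right_comm]⟩
  have hdeg : ∀ α t, ((Finset.univ.filter (R α t)).card : ℝ) ≤ 2 * k / h := by
    intro α t
    by_cases hα : t.1 = α
    · have : Finset.univ.filter (R α t) = ∅ :=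
        Finset.filter_eq_empty_iff.mpr fun u _ hu => ((hR α t u).mp hu).1 hα
      rw [this, Finset.card_empty, Nat.cast_zero]
      positivity
    · refine le_trans ?_ (hD (α + t.1) fun h0 => hα (add_eq_zero_cube h0).symm)
      refine Nat.cast_le.mpr (Finset.card_le_card_of_injOn Subtype.val (fun u hu => ?_)
        Subtype.val_injective.injOn)
      have hu' := (hR α t u).mp (Finset.mem_filter.mp (Finset.mem_coe.mp hu)).2
      exact Finset.mem_coe.mpr (mem_foldSet.mpr ⟨u.2, by rw [add_comm]; exact hu'.2.2.2⟩)
  have hdeg_lower : ∀ α, ∀ t : ι, t.1 ∈ foldPartners f ℓ α →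
      2 * k ^ ℓ ≤ ((Finset.univ.filter (R α t)).card : ℝ) := by
    intro α t ht
    obtain ⟨-, hne, hle⟩ := Finset.mem_filter.mp ht
    rw [← hkdef] at hle
    have hsub : foldSet f (α + t.1) ⊆
        ((Finset.univ.filter (R α t)).image Subtype.val) ∪ {α, t.1} := by
      intro u hu
      obtain ⟨hu1, hu2⟩ := mem_foldSet.mp hu
      rw [Finset.mem_union]
      by_cases h1 : u = α
      · right; simp [h1]
      by_cases h2 : u = t.1
      · right; simp [h2]
      left
      refine Finset.mem_image.mpr ⟨⟨u, hu1⟩, Finset.mem_filter.mpr ⟨Finset.mem_univ _,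
        (hR α t _).mpr ⟨hne, h1, fun h3 => h2 (congrArg Subtype.val h3).symm, ?_⟩⟩, rfl⟩
      rw [add_comm]
      exact hu2
    have h1 := (Finset.card_le_card hsub).trans (Finset.card_union_le _ _)
    have h2 : ((Finset.univ.filter (R α t)).image Subtype.val).card ≤
        (Finset.univ.filter (R α t)).card := Finset.card_image_le
    have h3 : ({α, t.1} : Finset (Cube n)).card ≤ 2 := Finset.card_le_two
    have h4 : (foldSet f (α + t.1)).card ≤ (Finset.univ.filter (R α t)).card + 2 := by omega
    have h5 : ((foldSet f (α + t.1)).card : ℝ) ≤ (Finset.univ.filter (R α t)).card + 2 := by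
      exact_mod_cast h4
    linarith
  have hsum_lower : ∀ α, ((foldPartners f ℓ α).card : ℝ) * (2 * k ^ ℓ) ≤
      ∑ t, ((Finset.univ.filter (R α t)).card : ℝ) := by
    intro α
    have h1 : (foldPartners f ℓ α).card =
        (Finset.univ.filter (fun t : ι => t.1 ∈ foldPartners f ℓ α)).card := by
      symm
      refine Finset.card_bij (fun t _ => t.1) (fun t ht => (Finset.mem_filter.mp ht).2)
        (fun _ _ _ _ h => Subtype.ext h) fun b hb => ?_
      exact ⟨⟨b, (Finset.mem_filter.mp hb).1⟩, by simpa using hb, rfl⟩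
    rw [h1, ← nsmul_eq_mul]
    refine (Finset.card_nsmul_le_sum _ _ _ fun t ht => ?_).trans
      (Finset.sum_le_sum_of_subset_of_nonneg (Finset.subset_univ _) fun _ _ _ =>
        Nat.cast_nonneg _)
    exact hdeg_lower α t (Finset.mem_filter.mp ht).2
  have hpow : k ^ (1 - ℓ) * k ^ ℓ = k := by
    rw [← Real.rpow_add hk0]
    simp
  let W := (Fin q → ι) × (Fin q → ι)
  let hit : Cube n → W → Prop := fun α p => ∃ i j, R α (p.1 i) (p.2 j)
  have hWcard : (Fintype.card W : ℝ) = k ^ q * k ^ q := by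
    simp [W, hcard, hkdef]
  have hW0 : (0 : ℝ) < Fintype.card W := by rw [hWcard]; positivity
  -- the constant is `y + 2 z + 1` with `y ≤ 2` and `z = q D / k ≤ 4`
  have hprob : ∀ α, (Fintype.card W : ℝ) * (2 * (foldPartners f ℓ α).card / k) ≤
      11 * ((Finset.univ.filter (hit α)).card : ℝ) := by
    intro α
    have hN : ((foldPartners f ℓ α).card : ℝ) ≤ k := by
      rw [hkdef]
      exact Nat.cast_le.mpr (Finset.card_le_card (foldPartners_subset f ℓ α))
    have h1 := sampled_edge_bound (R α) (hRsymm α) (2 * k / h) (hdeg α) q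
      (y := 2 * (foldPartners f ℓ α).card / k)
      (div_nonneg (mul_nonneg two_pos.le (Nat.cast_nonneg _)) hk0.le) (by
        rw [hcard, ← hkdef, div_le_div_iff₀ hk0 (pow_pos hk0 2)]
        have h2 : h ^ 2 ≤ (q : ℝ) ^ 2 := pow_le_pow_left₀ hh0.le hq 2
        have h3 := mul_le_mul h2 (hsum_lower α)
          (mul_nonneg (Nat.cast_nonneg _) (mul_nonneg two_pos.le (Real.rpow_nonneg hk0.le ℓ)))
          (sq_nonneg _)
        rw [hhl] at h3
        have h4 : k ^ (1 - ℓ) * (((foldPartners f ℓ α).card : ℝ) * (2 * k ^ ℓ)) =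
            2 * (foldPartners f ℓ α).card * k := by
          linear_combination (2 * ((foldPartners f ℓ α).card : ℝ)) * hpow
        rw [h4] at h3
        have h5 := mul_le_mul_of_nonneg_right h3 hk0.le
        linarith)
    rw [hcard, ← hkdef, ← hWcard] at h1
    refine h1.trans ?_
    have h6 : (q : ℝ) * (2 * k / h) / k ≤ 4 := by
      have : (q : ℝ) * (2 * k / h) / k = 2 * q / h := by field_simp
      rw [this, div_le_iff₀ hh0]
      linarith
    have h7 : 2 * ((foldPartners f ℓ α).card : ℝ) / k ≤ 2 := by
      rw [div_le_iff₀ hk0]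
      linarith
    refine mul_le_mul_of_nonneg_right (by linarith) (Nat.cast_nonneg _)
  -- double counting of the pairs of a frequency and a sample that merges it
  have hexists : ∃ p : W, δ * k ≤ 11 * ((S.filter (fun α => hit α p)).card : ℝ) := by
    by_contra hcon
    push Not at hcon
    have h1 : ∑ p : W, 11 * ((S.filter (fun α => hit α p)).card : ℝ) < ∑ p : W, δ * k :=
      Finset.sum_lt_sum_of_nonempty (Finset.univ_nonempty) fun p _ => hcon p
    rw [Finset.sum_const, Finset.card_univ, nsmul_eq_mul, ← Finset.mul_sum] at h1
    have h2 : ∑ p : W, ((S.filter (fun α => hit α p)).card : ℝ) =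
        ∑ α ∈ S, ((Finset.univ.filter (hit α)).card : ℝ) := by
      simp only [← Finset.sum_boole]
      exact Finset.sum_comm
    have h3 := Finset.sum_le_sum fun α (_ : α ∈ S) => hprob α
    rw [← Finset.mul_sum, ← Finset.mul_sum, ← Finset.sum_div, ← Finset.mul_sum, ← h2] at h3
    have h4 : δ * k ≤ 2 * (∑ α ∈ S, ((foldPartners f ℓ α).card : ℝ)) / k := by
      rw [le_div_iff₀ hk0]
      have h5 := hf.le_sum_card_foldPartners
      rw [← hkdef] at h5
      have h6 : 0 ≤ δ * (k * (k - 2)) := mul_nonneg hδ (mul_nonneg hk0.le (by linarith))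
      nlinarith
    have h7 := mul_le_mul_of_nonneg_left h4 hW0.le
    linarith
  obtain ⟨p, hp⟩ := hexists
  refine ⟨List.ofFn (fun i => (p.1 i).1) ++ List.ofFn (fun i => (p.2 i).1), ?_,
    S.filter (fun α => hit α p), Finset.filter_subset _ _, hp, ?_⟩
  · simp only [List.length_append, List.length_ofFn]
    omega
  · intro a ha L hL
    obtain ⟨i, j, hij⟩ := (Finset.mem_filter.mp ha).2
    obtain ⟨-, -, hne, hv⟩ := (hR _ _ _).mp hij
    have h1 : L (p.1 i).1 = 0 := hL _ (by simp)
    have h2 : L (p.2 j).1 = 0 := hL _ (by simp)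
    refine ⟨_, hv, fun h3 => hne (Subtype.ext (add_eq_zero_cube ?_)), ?_⟩
    · rw [add_assoc] at h3
      simpa using h3
    · rw [map_add, map_add, h1, h2, add_zero, add_zero]

/-- A batch of `m ≤ 4 h` queries reduces the sparsity `k` by at least `c m k / h`. A single query
with a large fold set allows `c = 1`; a random sample merges `δ k / 11` frequencies, hence lowers
the sparsity by `δ k / 22`, with at most `4 h` queries, which allows `c = δ / 88`. -/
theorem exists_query_batch (f : BoolFun n) {δ ℓ h c : ℝ} (hk : 2 ≤ sparsity f) (hδ : 0 ≤ δ)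
    (hf : IsFolding δ ℓ f) (hh : 1 ≤ h) (hhl : h ^ 2 = (sparsity f : ℝ) ^ (1 - ℓ))
    (hc0 : 0 ≤ c) (hc1 : c ≤ 1) (hcδ : 88 * c ≤ δ) :
    ∃ m : ℕ, 1 ≤ m ∧ (m : ℝ) ≤ 4 * h ∧ ∀ d : ℕ,
      (∀ g : BoolFun n, c * m * sparsity f ≤ h * ((sparsity f : ℝ) - sparsity g) → pdt g ≤ d) →
        pdt f ≤ d + m := by
  have hh0 : 0 < h := by linarith
  have hk0 : (0 : ℝ) < sparsity f := by exact_mod_cast (by omega : 0 < sparsity f)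
  by_cases hD : ∀ γ, γ ≠ 0 → ((foldSet f γ).card : ℝ) ≤ 2 * sparsity f / h
  · have hq : h ≤ (⌈h⌉₊ : ℝ) := Nat.le_ceil h
    have hq2 : (⌈h⌉₊ : ℝ) ≤ 2 * h := by linarith [Nat.ceil_lt_add_one hh0.le]
    obtain ⟨Q, hQ, B, hBS, hB, hmerge⟩ := exists_sample f hk hδ hf hh hhl hq hq2 hD
    refine ⟨2 * ⌈h⌉₊, ?_, by push_cast; linarith, fun d hd => ?_⟩
    · have := Nat.ceil_pos.mpr hh0
      omega
    · rw [← hQ]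
      refine pdt_le_of_merge f Q B hBS hmerge fun g hg => hd g ?_
      have h1 : 2 * (sparsity g : ℝ) + B.card ≤ 2 * sparsity f := by exact_mod_cast hg
      have h2 : c * (2 * ⌈h⌉₊ : ℝ) ≤ h * (4 * c) := by nlinarith
      have h3 : c * (2 * ⌈h⌉₊ : ℝ) * sparsity f ≤ h * (4 * c) * sparsity f :=
        mul_le_mul_of_nonneg_right h2 hk0.le
      have h4 : 4 * c * sparsity f ≤ (sparsity f : ℝ) - sparsity g := by
        have : 88 * c * sparsity f ≤ δ * sparsity f := mul_le_mul_of_nonneg_right hcδ hk0.le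
        linarith
      have h5 := mul_le_mul_of_nonneg_left h4 hh0.le
      push_cast
      linarith
  · push Not at hD
    obtain ⟨γ, hγ, hcard⟩ := hD
    refine ⟨1, le_rfl, by push_cast; linarith, fun d hd => ?_⟩
    refine pdt_le_of_foldSet f hγ fun g hg => hd g ?_
    have h1 : 2 * (sparsity g : ℝ) + (foldSet f γ).card ≤ 2 * sparsity f := by exact_mod_cast hg
    rw [div_lt_iff₀ hh0] at hcard
    have h2 : c * sparsity f ≤ 1 * sparsity f := mul_le_mul_of_nonneg_right hc1 hk0.le
    push_cast
    nlinarith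

/-! ### Iteration -/

/-- Let the functions of sparsity `k ≥ K` be folding, with `k ^ ((1 - ℓ) / 2) ≤ H` in the range
`K ≤ k ≤ N`. The costs of successive batches telescope: a batch of `m` queries that takes the sparsity from `k` to `k'` is
paid for by `m ≤ (H / c) (1 - k' / k) ≤ (H / c) (log k - log k')`. -/
theorem pdt_le_add_log {δ ℓ : ℕ → ℝ} {c H : ℝ} {K N : ℕ} (hc0 : 0 < c) (hc1 : c ≤ 1 / 8)
    (hcδ : ∀ k, 88 * c ≤ δ k) (hl : ∀ k, ℓ k ≤ 1)
    (hH : ∀ k, K ≤ k → k ≤ N → (k : ℝ) ^ ((1 - ℓ k) / 2) ≤ H) (hH0 : 0 ≤ H)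
    (hfold : ∀ g : BoolFun n, K ≤ sparsity g →
      IsFolding (δ (sparsity g)) (ℓ (sparsity g)) g) (f : BoolFun n) (hN : sparsity f ≤ N) :
    (pdt f : ℝ) ≤ (max K 2 : ℕ) + H / c * Real.log (sparsity f) := by
  induction hs : sparsity f using Nat.strong_induction_on generalizing f with
  | _ k ih =>
  subst hs
  set k := sparsity f with hk
  have hkpos : 0 < k := sparsity_pos f
  have hkR : (0 : ℝ) < k := by exact_mod_cast hkpos
  have hHc : 0 ≤ H / c := div_nonneg hH0 hc0.le
  rcases lt_or_ge k (max K 2) with hlt | hge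
  · have h1 : (pdt f : ℝ) ≤ (max K 2 : ℕ) := Nat.cast_le.mpr ((pdt_le_sparsity f).trans hlt.le)
    have h2 : 0 ≤ Real.log k := Real.log_natCast_nonneg k
    have := mul_nonneg hHc h2
    linarith
  · have hK : K ≤ k := (le_max_left _ _).trans hge
    have hk2 : 2 ≤ k := (le_max_right _ _).trans hge
    have hk2R : (2 : ℝ) ≤ k := by exact_mod_cast hk2
    set h : ℝ := (k : ℝ) ^ ((1 - ℓ k) / 2) with hh
    have hh1 : 1 ≤ h := Real.one_le_rpow (by linarith) (by linarith [hl k])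
    have hhH : h ≤ H := hH k hK hN
    have hhl : h ^ 2 = (k : ℝ) ^ (1 - ℓ k) := by
      rw [hh, ← Real.rpow_natCast, ← Real.rpow_mul hkR.le]
      congr 1
      push_cast
      ring
    have hδ : 0 ≤ δ k := le_trans (by positivity) (hcδ k)
    obtain ⟨m, hm1, hm4, hm⟩ := exists_query_batch f hk2 hδ (hfold f hK) hh1 hhl hc0.le
      (by linarith) (hcδ k)
    set Rb : ℝ := (max K 2 : ℕ) + H / c * Real.log k - m with hRb
    -- keeps the bound left for the restrictions nonnegative, so that its floor can be used
    have hm4c : (m : ℝ) ≤ H / c * Real.log k := by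
      have hlog : 1 / 2 ≤ Real.log k :=
        le_trans (by linarith [Real.log_two_gt_d9]) (Real.log_le_log two_pos hk2R)
      have h1 : 8 * H ≤ H / c := by
        rw [le_div_iff₀ hc0]
        nlinarith
      nlinarith
    have hRb0 : 0 ≤ Rb := by
      have : (0 : ℝ) ≤ (max K 2 : ℕ) := Nat.cast_nonneg _
      linarith
    have hfin := hm ⌊Rb⌋₊ fun g hg => ?_
    · have h1 : (pdt f : ℝ) ≤ ⌊Rb⌋₊ + m := by exact_mod_cast hfin
      linarith [Nat.floor_le hRb0]
    · rw [← hk] at hg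
      have hm1R : (1 : ℝ) ≤ m := by exact_mod_cast hm1
      have hgpos : (0 : ℝ) < sparsity g := by exact_mod_cast sparsity_pos g
      have hpos : 0 < c * m * k := by positivity
      have hltR : (sparsity g : ℝ) < k := by
        have := pos_of_mul_pos_right (hpos.trans_le hg) (by linarith)
        linarith
      have hlt : sparsity g < k := by exact_mod_cast hltR
      have hih := ih _ hlt g (hlt.le.trans hN) rfl
      have hlog : 1 - (sparsity g : ℝ) / k ≤ Real.log k - Real.log (sparsity g) := by
        have h1 := Real.one_sub_inv_le_log_of_pos (div_pos hkR hgpos)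
        rwa [inv_div, Real.log_div hkR.ne' hgpos.ne'] at h1
      have hcost : (m : ℝ) ≤ H / c * (Real.log k - Real.log (sparsity g)) := by
        refine le_trans ?_ (mul_le_mul_of_nonneg_left hlog hHc)
        have h1 : c * m * k ≤ H * ((k : ℝ) - sparsity g) :=
          hg.trans (mul_le_mul_of_nonneg_right hhH (by linarith))
        have h2 : H / c * (1 - (sparsity g : ℝ) / k) = H * ((k : ℝ) - sparsity g) / (c * k) := by
          field_simp
        rw [h2, le_div_iff₀ (by positivity)]
        linarith
      refine Nat.le_floor ?_
      rw [hRb]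
      linarith

end PDTree

theorem corollary3 (ε δ₀ : ℝ) (hε : 0 < ε) (hδ₀ : 0 < δ₀) (K₀ : ℕ) :
    ∃ (C : ℝ) (c : ℕ), ∀ δ ℓ : ℕ → ℝ,
      (∀ k, δ₀ ≤ δ k) →
      (∀ k, 0 ≤ ℓ k ∧ ℓ k ≤ 1 - ε) →
      MonotoneOn (fun k : ℕ => (k : ℝ) ^ (1 - ℓ k)) (Set.Ici K₀) →
      (∀ (m : ℕ) (g : PDTree.BoolFun m), K₀ ≤ PDTree.sparsity g →
        PDTree.IsFolding (δ (PDTree.sparsity g)) (ℓ (PDTree.sparsity g)) g) →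
      ∀ (n : ℕ) (f : PDTree.BoolFun n), 2 ≤ PDTree.sparsity f →
        (PDTree.pdt f : ℝ) ≤
          C * (PDTree.sparsity f : ℝ) ^ ((1 - ℓ (PDTree.sparsity f)) / 2) *
            (Real.logb 2 ((PDTree.sparsity f : ℝ) ^ ((1 - ℓ (PDTree.sparsity f)) / 2))) ^ c := by
  set c₀ : ℝ := min (1 / 8) (δ₀ / 88) with hc₀
  have hc0 : 0 < c₀ := lt_min (by norm_num) (by positivity)
  have hc1 : c₀ ≤ 1 / 8 := min_le_left _ _
  have hc2 : 88 * c₀ ≤ δ₀ := by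
    have : c₀ ≤ δ₀ / 88 := min_le_right _ _
    linarith
  set A : ℝ := ((max K₀ 2 : ℕ) : ℝ) with hA
  have hA0 : 0 ≤ A := Nat.cast_nonneg _
  refine ⟨(A + 1 / c₀) * (2 / ε), 1, fun δ ℓ hδ hℓ hmono hfold n f hf => ?_⟩
  set k := PDTree.sparsity f with hk
  have hk2 : (2 : ℝ) ≤ k := by exact_mod_cast hf
  have hk0 : (0 : ℝ) < k := by linarith
  have hl : ∀ j, ℓ j ≤ 1 := fun j => by linarith [(hℓ j).2]
  set h : ℝ := (k : ℝ) ^ ((1 - ℓ k) / 2) with hh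
  have hh1 : 1 ≤ h := Real.one_le_rpow (by linarith) (by linarith [hl k])
  have hlogk : 1 ≤ Real.logb 2 k := by
    rw [Real.le_logb_iff_rpow_le one_lt_two hk0]
    simpa using hk2
  have hlogh : ε / 2 * Real.logb 2 k ≤ Real.logb 2 h := by
    rw [hh, Real.logb_rpow_eq_mul_logb_of_pos hk0]
    exact mul_le_mul_of_nonneg_right (by linarith [(hℓ k).2]) (by linarith)
  have hmain : (PDTree.pdt f : ℝ) ≤ (A + 1 / c₀) * h * Real.logb 2 k := by
    have hinv : 0 < 1 / c₀ := by positivity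
    have hhlog : 1 ≤ h * Real.logb 2 k := by nlinarith
    rcases lt_or_ge k K₀ with hlt | hge
    · have h1 : (PDTree.pdt f : ℝ) ≤ A :=
        Nat.cast_le.mpr ((PDTree.pdt_le_sparsity f).trans (hlt.le.trans (le_max_left _ _)))
      nlinarith
    · have hH : ∀ j, K₀ ≤ j → j ≤ k → (j : ℝ) ^ ((1 - ℓ j) / 2) ≤ h := by
        intro j hj hjk
        have h1 : (j : ℝ) ^ (1 - ℓ j) ≤ (k : ℝ) ^ (1 - ℓ k) := hmono hj hge hjk
        have h2 := Real.rpow_le_rpow (Real.rpow_nonneg (Nat.cast_nonneg j) _) h1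
          (by norm_num : (0 : ℝ) ≤ 1 / 2)
        rw [← Real.rpow_mul (Nat.cast_nonneg j), ← Real.rpow_mul hk0.le] at h2
        rw [hh]
        convert h2 using 2 <;> ring
      have h3 := PDTree.pdt_le_add_log (n := n) hc0 hc1 (fun j => hc2.trans (hδ j)) hl hH
        (by linarith) (hfold n) f le_rfl
      rw [← hk, ← hA] at h3
      have h4 : Real.log k ≤ Real.logb 2 k := by
        rw [Real.logb, le_div_iff₀ (Real.log_pos one_lt_two)]
        have h5 : 0 ≤ Real.log k := Real.log_natCast_nonneg k
        nlinarith [Real.log_two_lt_d9]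
      have h6 : h / c₀ * Real.log k ≤ h / c₀ * Real.logb 2 k :=
        mul_le_mul_of_nonneg_left h4 (by positivity)
      have h7 : A * 1 ≤ A * (h * Real.logb 2 k) := mul_le_mul_of_nonneg_left hhlog hA0
      calc (PDTree.pdt f : ℝ) ≤ A * (h * Real.logb 2 k) + h / c₀ * Real.logb 2 k := by linarith
        _ = (A + 1 / c₀) * h * Real.logb 2 k := by ring
  rw [pow_one]
  calc (PDTree.pdt f : ℝ) ≤ (A + 1 / c₀) * h * Real.logb 2 k := hmain
    _ = (A + 1 / c₀) * (2 / ε) * h * (ε / 2 * Real.logb 2 k) := by field_simp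
    _ ≤ (A + 1 / c₀) * (2 / ε) * h * Real.logb 2 h := by gcongr
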